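/- **Setting.** There are $T$ queries and $M$ models. At query $t$ model $m$ yields a Bernoulli reward with mean $\mu_{t,m}\in[0,1]$, independently over queries; it has cost $c_m>0$, throughput limit $\alpha_m$, and is available from query $t_m$ on; $\mathcal M_t=\{m: t_m\le t\}$. The horizon is divided into $K$ equal stages ($K\mid T$) starting at $\tau_k=(k-1)T/K+1$. An online policy $\mathcal A$ with concurrency cap $M_{\max}$ chooses (possibly at random, from the past record of deployments, selected models and rewards) a nonempty deployed set of at most $M_{\max}$ models at each $\tau_k$, keeps it during the stage, and at each query $t$ chooses (possibly at random) a model $m_t$ from the deployed set. For a budget $b$ and a set $\mathcal S$ of models let $$V_t(b,\mathcal S)=\max\Big\{\sum_{m\in\mathcal S}\mu_{t,m}p(m)\;:\;p\in\Delta(\mathcal S),\ \sum_{m}c_m p(m)\le b,\ p(m)\le\alpha_m,\ |\mathrm{supp}(p)|\le M_{\max}\Big\}$$ (and $0$ if no $p$ is feasible). The regret against the time-varying oracle is $$\mathrm{Regret}(\mathcal A)=\sum_{t=1}^T V_t(b,\mathcal M_t)-\mathbb E\Big[\sum_{t=1}^T\mu_{t,m_t}\Big],$$ and the regret against the stage-start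 benchmark is $$\mathrm{Regret}^{*}(\mathcal A)=\sum_{k=1}^K \tfrac TK\,V_{\tau_k}(b,\mathcal M_{\tau_k})-\mathbb E\Big[\sum_{t=1}^T\mu_{t,m_t}\Big].$$ **Theorem.** There are universal constants $c,c_1,c_2,C_0>0$ such that the following holds for all $M\ge 2$, all $T\ge C_0M$ and all $K\ge1$ with $K\mid T$. There are a batch length $\Delta\in\{1,\dots,T\}$ with $c_1M^{1/3}T^{2/3}\le\Delta\le c_2M^{1/3}T^{2/3}$ and a gap $\varepsilon$ with $c_1(M/T)^{1/3}\le\varepsilon\le c_2(M/T)^{1/3}$ and $\lceil T/\Delta\rceil\,\varepsilon\le\frac14$ such that, for every concurrency cap $M_{\max}\ge1$, every budget $b\ge1$ and every online policy $\mathcal A$, there is a sequence $s_1,s_2,\dots\in\{1,\dots,M\}$ for which the following piecewise-stationary instance is hard. The horizon is cut into consecutive batches of length $\Delta$ (the last one possibly shorter); in batch $j$ the reward of model $s_j$ is Bernoulli with mean $\frac12+j\varepsilon$ and the reward of every other model is Bernoulli with mean $\frac12+(j-1)\varepsilon$; all $M$ models are available throughout, with $c_m=1$ and $\alpha_m=1$.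 On this instance $$\mathrm{Regret}(\mathcal A)\ \ge\ c\,M^{1/3}T^{2/3},$$ and, if moreover $T\le 2C_0MK^3$, then also $\mathrm{Regret}^{*}(\mathcal A)\ge c\,M^{1/3}T^{2/3}$. In particular, for any fixed number $M\ge2$ of models, any $K$ and any $M_{\max}$, the regret of every online policy against the time-varying oracle is $\Omega(T^{2/3})$ on some such instance. -/

import Mathlib

/-!
Online deployment and routing over `M` models and `T` rounds (queries). Rounds, stages and batches
are numbered from `0`, so round `t` below is the query number `t + 1`.
-/

namespace LLMRouting

/-- A stochastic routing instance with `M` models and horizon `T`, with Bernoulli rewards whose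
means may change from round to round, and with deterministic costs. -/
structure RoutingInstance (T M : ℕ) where
  /-- `mean t m` is the mean of the Bernoulli reward of model `m` at round `t`. -/
  mean : ℕ → Fin M → ℝ
  mean_mem : ∀ t < T, ∀ m, mean t m ∈ Set.Icc (0 : ℝ) 1
  /-- operational cost of one invocation of a model -/
  cost : Fin M → ℝ
  cost_pos : ∀ m, 0 < cost m
  /-- throughput limit of a model -/
  throughput : Fin M → ℝ
  /-- first round at which a model is available -/
  avail : Fin M → ℕ

/-- The pool of the models that are available at round `t`. -/
def RoutingInstance.pool {T M : ℕ} (I : RoutingInstance T M) (t : ℕ) : Finset (Fin M) :=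
  Finset.univ.filter fun m => I.avail m ≤ t

/-- The optimal performance rate `V(b, S)` for the reward means of round `t`: the largest expected
reward of one query over the distributions on `S` that respect the budget `b`, the throughput limits
and the concurrency cap `Mmax`. It is `0` if there is no such distribution. -/
noncomputable def RoutingInstance.rate {T M : ℕ} (I : RoutingInstance T M) (t : ℕ) (b : ℝ)
    (Mmax : ℕ) (S : Finset (Fin M)) : ℝ :=
  sSup {v : ℝ | ∃ p : Fin M → ℝ, (∀ m, 0 ≤ p m) ∧ (∀ m, m ∉ S → p m = 0) ∧ ∑ m, p m = 1 ∧
    ∑ m, I.cost m * p m ≤ b ∧ (∀ m ∈ S, p m ≤ I.throughput m) ∧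
    (Finset.univ.filter fun m => p m ≠ 0).card ≤ Mmax ∧ v = ∑ m, I.mean t m * p m}

/-- The record of one round: the deployed set, the selected model and its Bernoulli reward. -/
abbrev Round (M : ℕ) : Type := Finset (Fin M) × Fin M × Bool

/-- A randomized online policy with concurrency cap `Mmax`. At the first round of a stage it draws
the set to deploy from `deploy t h`, and at every round it draws the model that serves the query
from `route t h D`, where `h` is the record of the `t` rounds so far and `D` the deployed set.
(Availability, throughput and budget are not imposed here: a lower bound for all such policies holds
in particular for those that respect them.) -/
structure Policy (M Mmax : ℕ) where
  deploy : (t : ℕ) → (Fin t → Round M) → PMF (Finset (Fin M))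
  route : (t : ℕ) → (Fin t → Round M) → Finset (Fin M) → PMF (Fin M)
  deploy_nonempty : ∀ t h, ∀ D ∈ (deploy t h).support, D.Nonempty
  deploy_card : ∀ t h, ∀ D ∈ (deploy t h).support, D.card ≤ Mmax
  route_mem : ∀ t h D, D.Nonempty → ∀ m ∈ (route t h D).support, m ∈ D

/-- The distribution of the set deployed at round `t` after the record `h`, for stages of length
`L`: a fresh draw if a stage starts at round `t`, otherwise the set of the previous round. -/
noncomputable def Policy.deployed {M Mmax : ℕ} (A : Policy M Mmax) (L t : ℕ)
    (h : Fin t → Round M) : PMF (Finset (Fin M)) :=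
  if hL : L ∣ t then A.deploy t h
  else PMF.pure (h ⟨t - 1, Nat.sub_lt (Nat.pos_of_ne_zero fun h0 => hL (h0 ▸ dvd_zero L))
    Nat.one_pos⟩).1

/-- The probability that the first `t` rounds of policy `A` on instance `I`, with stages of length
`L`, have the record `h`. -/
noncomputable def Policy.pathProb {T M Mmax : ℕ} (A : Policy M Mmax) (I : RoutingInstance T M)
    (L : ℕ) : (t : ℕ) → (Fin t → Round M) → ℝ
  | 0, _ => 1
  | t + 1, h =>
    let past : Fin t → Round M := fun i => h i.castSucc
    let D : Finset (Fin M) := (h (Fin.last t)).1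
    let m : Fin M := (h (Fin.last t)).2.1
    A.pathProb I L t past * (A.deployed L t past D).toReal * (A.route t past D m).toReal *
      (if (h (Fin.last t)).2.2 then I.mean t m else 1 - I.mean t m)

/-- The expected cumulative performance of policy `A`, the expectation of the sum over the rounds of
the mean reward of the selected model, when the horizon `T` is divided into `K` equal stages. -/
noncomputable def Policy.performance {T M Mmax : ℕ} (A : Policy M Mmax) (I : RoutingInstance T M)
    (K : ℕ) : ℝ :=
  ∑ h : Fin T → Round M, A.pathProb I (T / K) T h * ∑ t : Fin T, I.mean t (h t).2.1

/-- Regret against the time-varying oracle that attains at each round the optimal rate of the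
current pool for the current means. -/
noncomputable def Policy.regret {T M Mmax : ℕ} (A : Policy M Mmax) (I : RoutingInstance T M)
    (K : ℕ) (b : ℝ) : ℝ :=
  (∑ t ∈ Finset.range T, I.rate t b Mmax (I.pool t)) - A.performance I K

/-- Regret against the benchmark `OPT^*` that evaluates the optimal rate at the stage starts only
and weighs it with the stage length `T / K`. -/
noncomputable def Policy.stageRegret {T M Mmax : ℕ} (A : Policy M Mmax) (I : RoutingInstance T M)
    (K : ℕ) (b : ℝ) : ℝ :=
  (∑ k ∈ Finset.range K,
    ((T / K : ℕ) : ℝ) * I.rate (k * (T / K)) b Mmax (I.pool (k * (T / K)))) - A.performance I K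

/-- The piecewise-stationary drifting instance: the rounds are cut into batches of length `Δ` (the
last one possibly shorter). In batch `j = 0, 1, …` the model `s j` has mean `1/2 + (j + 1) ε` and all
other models have mean `1/2 + j ε`. All models are always available, have unit cost and no
effective throughput limit. -/
structure RoutingInstance.IsDriftingBatch {T M : ℕ} (I : RoutingInstance T M) (Δ : ℕ) (ε : ℝ)
    (s : ℕ → Fin M) : Prop where
  strong : ∀ t < T, I.mean t (s (t / Δ)) = 1 / 2 + (((t / Δ : ℕ) : ℝ) + 1) * ε
  weak : ∀ t < T, ∀ m, m ≠ s (t / Δ) → I.mean t m = 1 / 2 + ((t / Δ : ℕ) : ℝ) * ε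
  cost_eq : ∀ m, I.cost m = 1
  throughput_eq : ∀ m, I.throughput m = 1
  avail_eq : ∀ m, I.avail m = 0

end LLMRouting

/-!
Suppose first that no model is strong during a batch of `n ≤ Δ` rounds. Then some model `a` is
selected at most `n / M` times in expectation. Making `a` the strong model of the batch changes only
the rewards of the rounds in which `a` is selected, so it moves the law of the record by a relative
entropy of order `ε² n / M`, which is small as `ε² Δ` is small against `M`. By an inequality of
Pinsker type the policy still misses `a` in a quarter of the rounds, at a price of `ε` each. A
policy does not see the future, so the strong models can be fixed batch by batch, and the total
regret is at least `ε T / 4`. The constraints `ε² Δ ≲ M` and `ε T / Δ ≲ 1` (the means stay bounded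
away from `1`) lead to `ε ≍ (M / T) ^ (1/3)` and `Δ ≍ ε T`.
-/

namespace LLMRouting

open Finset Real

section RelativeEntropy

variable {Ω : Type*} [Fintype Ω] {P Q : Ω → ℝ}

/-- The relative entropy (Kullback-Leibler divergence) of two weight functions on a finite type.
A point with `Q ω = 0 < P ω` contributes `0` rather than `∞`, so absolute continuity of `P` with
respect to `Q` is a separate hypothesis where it matters. -/
noncomputable def relEntropy (P Q : Ω → ℝ) : ℝ := ∑ ω, P ω * log (P ω / Q ω)

lemma relEntropy_self (P : Ω → ℝ) : relEntropy P P = 0 := by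
  refine sum_eq_zero fun ω _ => ?_
  obtain h | h := eq_or_ne (P ω) 0 <;> simp [h]

lemma relEntropy_le_sum_sq_div (hP : P ∈ stdSimplex ℝ Ω) (hQ : Q ∈ stdSimplex ℝ Ω)
    (hQ0 : ∀ ω, 0 < Q ω) : relEntropy P Q ≤ ∑ ω, (P ω - Q ω) ^ 2 / Q ω := by
  have hpoint : ∀ ω, P ω * log (P ω / Q ω) ≤ (P ω - Q ω) ^ 2 / Q ω + (P ω - Q ω) := by
    intro ω
    have hQω := (hQ0 ω).ne'
    have hsq : (P ω - Q ω) ^ 2 / Q ω + (P ω - Q ω) = P ω * (P ω / Q ω - 1) := by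
      field_simp
      ring
    rw [hsq]
    obtain h | h := (hP.1 ω).eq_or_lt
    · simp [← h]
    · exact mul_le_mul_of_nonneg_left (log_le_sub_one_of_pos (div_pos h (hQ0 ω))) h.le
  refine (sum_le_sum fun ω _ => hpoint ω).trans_eq ?_
  rw [sum_add_distrib, sum_sub_distrib, hP.2, hQ.2, sub_self, add_zero]

lemma sq_sqrt_sub_sqrt_le {p q : ℝ} (hp : 0 ≤ p) (hq : 0 ≤ q) (hpq : q = 0 → p = 0) :
    (√p - √q) ^ 2 ≤ p * log (p / q) - p + q := by
  obtain rfl | hp := hp.eq_or_lt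
  · simp [sq_sqrt hq]
  have hq : 0 < q := hq.lt_of_ne' fun h => hp.ne' (hpq h)
  have hlog : -log (p / q) ≤ 2 * (√q / √p - 1) := by
    have := log_le_sub_one_of_pos (div_pos (sqrt_pos.2 hq) (sqrt_pos.2 hp))
    rw [← sqrt_div hq.le, log_sqrt (by positivity), ← inv_div p q, log_inv,
      inv_div, sqrt_div hq.le] at this
    linarith
  have hmul : p * (√q / √p) = √p * √q := by
    nth_rw 1 [← mul_self_sqrt hp.le]
    field_simp
  have := mul_le_mul_of_nonneg_left hlog hp.le
  rw [mul_left_comm, mul_sub, hmul] at this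
  rw [sub_sq, sq_sqrt hp.le, sq_sqrt hq.le]
  linarith

lemma sum_sq_sqrt_sub_sqrt_le_relEntropy (hP : P ∈ stdSimplex ℝ Ω) (hQ : Q ∈ stdSimplex ℝ Ω)
    (hPQ : ∀ ω, Q ω = 0 → P ω = 0) : ∑ ω, (√(P ω) - √(Q ω)) ^ 2 ≤ relEntropy P Q := by
  refine (sum_le_sum fun ω _ => sq_sqrt_sub_sqrt_le (hP.1 ω) (hQ.1 ω) (hPQ ω)).trans_eq ?_
  rw [sum_add_distrib, sum_sub_distrib, hP.2, hQ.2, sub_add_cancel, relEntropy]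

lemma sum_abs_sub_le_two_mul_sqrt_relEntropy (hP : P ∈ stdSimplex ℝ Ω)
    (hQ : Q ∈ stdSimplex ℝ Ω) (hPQ : ∀ ω, Q ω = 0 → P ω = 0) :
    ∑ ω, |P ω - Q ω| ≤ 2 * √(relEntropy P Q) := by
  have hfactor : ∀ ω, |P ω - Q ω| = |√(P ω) - √(Q ω)| * (√(P ω) + √(Q ω)) := by
    intro ω
    rw [← abs_of_nonneg (by positivity : 0 ≤ √(P ω) + √(Q ω)), ← abs_mul, mul_comm, ← sq_sub_sq,
      sq_sqrt (hP.1 ω), sq_sqrt (hQ.1 ω)]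
  have hplus : ∑ ω, (√(P ω) + √(Q ω)) ^ 2 ≤ 2 ^ 2 := by
    refine (sum_le_sum fun ω _ => add_sq_le).trans_eq ?_
    simp only [sq_sqrt (hP.1 _), sq_sqrt (hQ.1 _), ← mul_sum, sum_add_distrib, hP.2, hQ.2]
    norm_num
  have hminus : ∑ ω, |√(P ω) - √(Q ω)| ^ 2 ≤ relEntropy P Q := by
    simpa only [sq_abs] using sum_sq_sqrt_sub_sqrt_le_relEntropy hP hQ hPQ
  calc ∑ ω, |P ω - Q ω|
      = ∑ ω, |√(P ω) - √(Q ω)| * (√(P ω) + √(Q ω)) := sum_congr rfl fun ω _ => hfactor ω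
    _ ≤ √(∑ ω, |√(P ω) - √(Q ω)| ^ 2) * √(∑ ω, (√(P ω) + √(Q ω)) ^ 2) :=
        sum_mul_le_sqrt_mul_sqrt _ _ _
    _ ≤ √(relEntropy P Q) * 2 :=
        mul_le_mul (sqrt_le_sqrt hminus) (sqrt_le_left (by norm_num) |>.2 hplus) (sqrt_nonneg _)
          (sqrt_nonneg _)
    _ = 2 * √(relEntropy P Q) := mul_comm _ _

lemma sum_mul_le_sum_mul_add_sqrt_relEntropy (hP : P ∈ stdSimplex ℝ Ω)
    (hQ : Q ∈ stdSimplex ℝ Ω) (hPQ : ∀ ω, Q ω = 0 → P ω = 0) {f : Ω → ℝ} {b : ℝ}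
    (hf : ∀ ω, f ω ∈ Set.Icc 0 b) :
    ∑ ω, Q ω * f ω ≤ ∑ ω, P ω * f ω + b * √(relEntropy P Q) := by
  obtain hΩ | ⟨⟨ω₀⟩⟩ := isEmpty_or_nonempty Ω
  · simp [relEntropy]
  have hb : 0 ≤ b / 2 := by linarith [(hf ω₀).1.trans (hf ω₀).2]
  -- Centering `f` at `b / 2` is free, as `P` and `Q` have the same mass, and saves a factor.
  have hcenter : ∑ ω, Q ω * f ω - ∑ ω, P ω * f ω = ∑ ω, (f ω - b / 2) * (Q ω - P ω) := by
    simp only [sub_mul, mul_sub, sum_sub_distrib, ← mul_sum, hP.2, hQ.2, mul_comm (f _)]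
    ring
  have hpoint : ∀ ω, (f ω - b / 2) * (Q ω - P ω) ≤ b / 2 * |P ω - Q ω| := by
    intro ω
    rw [abs_sub_comm]
    refine (le_abs_self _).trans ?_
    rw [abs_mul]
    refine mul_le_mul_of_nonneg_right (abs_le.2 ⟨?_, ?_⟩) (abs_nonneg _)
    · linarith [(hf ω).1]
    · linarith [(hf ω).2]
  have hsum := sum_le_sum fun ω (_ : ω ∈ univ) => hpoint ω
  rw [← hcenter, ← mul_sum] at hsum
  have := mul_le_mul_of_nonneg_left (sum_abs_sub_le_two_mul_sqrt_relEntropy hP hQ hPQ) hb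
  linarith

end RelativeEntropy

section Weights

/-- The weights of the Bernoulli distribution with mean `p`, as real numbers. -/
def rewardProb (p : ℝ) (r : Bool) : ℝ := if r then p else 1 - p

lemma sum_rewardProb (p : ℝ) : ∑ r, rewardProb p r = 1 := by simp [rewardProb]

lemma rewardProb_mem_stdSimplex {p : ℝ} (hp : p ∈ Set.Icc (0 : ℝ) 1) :
    rewardProb p ∈ stdSimplex ℝ Bool := by
  refine ⟨fun r => ?_, sum_rewardProb p⟩
  cases r
  · simpa [rewardProb] using hp.2
  · simpa [rewardProb] using hp.1

lemma rewardProb_pos {p : ℝ} (hp : p ∈ Set.Ioo (0 : ℝ) 1) (r : Bool) : 0 < rewardProb p r := by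
  cases r
  · simpa [rewardProb] using hp.2
  · simpa [rewardProb] using hp.1

lemma relEntropy_rewardProb_le {p q : ℝ} (hp : p ∈ Set.Icc (0 : ℝ) 1)
    (hq : q ∈ Set.Ioo (0 : ℝ) 1) :
    relEntropy (rewardProb p) (rewardProb q) ≤ (p - q) ^ 2 / (q * (1 - q)) := by
  refine (relEntropy_le_sum_sq_div (rewardProb_mem_stdSimplex hp)
    (rewardProb_mem_stdSimplex (Set.Ioo_subset_Icc_self hq)) (rewardProb_pos hq)).trans_eq ?_
  have hq0 := hq.1.ne'
  have hq1 : 1 - q ≠ 0 := (sub_pos.2 hq.2).ne'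
  simp only [Fintype.sum_bool, rewardProb, if_true, Bool.false_eq_true, if_false]
  field_simp
  ring

lemma sum_toReal_pmf {α : Type*} [Fintype α] (p : PMF α) : ∑ x, (p x).toReal = 1 := by
  rw [← ENNReal.toReal_sum fun x _ => p.apply_ne_top x, ← tsum_fintype (L := .unconditional _),
    p.tsum_coe, ENNReal.toReal_one]

end Weights

namespace Policy

section Law

variable {T M Mmax : ℕ} (A : Policy M Mmax) (I : RoutingInstance T M) (L : ℕ)

/-- The expectation of a function of the record of the first `t` rounds, for stages of length
`L`. -/
noncomputable def pathExp (t : ℕ) (f : (Fin t → Round M) → ℝ) : ℝ :=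
  ∑ h, A.pathProb I L t h * f h

/-- The probability that model `m` serves the query of round `t`, for stages of length `L`. -/
noncomputable def selectProb (t : ℕ) (m : Fin M) : ℝ :=
  A.pathExp I L (t + 1) fun h => if (h (Fin.last t)).2.1 = m then 1 else 0

lemma pathExp_sum {ι : Type*} (S : Finset ι) (t : ℕ) (f : ι → (Fin t → Round M) → ℝ) :
    A.pathExp I L t (fun h => ∑ i ∈ S, f i h) = ∑ i ∈ S, A.pathExp I L t (f i) := by
  simp only [pathExp, mul_sum]
  exact sum_comm

lemma pathExp_mul_const (t : ℕ) (f : (Fin t → Round M) → ℝ) (c : ℝ) :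
    A.pathExp I L t (fun h => f h * c) = A.pathExp I L t f * c := by
  simp only [pathExp, sum_mul, mul_assoc]

lemma pathProb_succ (t : ℕ) (h : Fin (t + 1) → Round M) :
    A.pathProb I L (t + 1) h = A.pathProb I L t (fun i => h i.castSucc) *
      (A.deployed L t (fun i => h i.castSucc) (h (Fin.last t)).1).toReal *
      (A.route t (fun i => h i.castSucc) (h (Fin.last t)).1 (h (Fin.last t)).2.1).toReal *
      rewardProb (I.mean t (h (Fin.last t)).2.1) (h (Fin.last t)).2.2 :=
  rfl

lemma pathExp_succ (t : ℕ) (f : (Fin (t + 1) → Round M) → ℝ) :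
    A.pathExp I L (t + 1) f = A.pathExp I L t fun h =>
      ∑ D, (A.deployed L t h D).toReal * ∑ m, (A.route t h D m).toReal *
        ∑ r, rewardProb (I.mean t m) r * f (Fin.snoc (α := fun _ => Round M) h (D, m, r)) := by
  unfold pathExp
  rw [← (Fin.snocEquiv fun _ => Round M).sum_comp, Fintype.sum_prod_type, sum_comm]
  refine sum_congr rfl fun h _ => ?_
  have hsnoc : ∀ x : Round M, Fin.snocEquiv (fun _ => Round M) (x, h) =
      Fin.snoc (α := fun _ => Round M) h x := fun _ => rfl
  simp only [Fintype.sum_prod_type, mul_sum, hsnoc, pathProb_succ, Fin.snoc_castSucc,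
    Fin.snoc_last, mul_assoc]

lemma pathExp_castSucc (t : ℕ) (f : (Fin t → Round M) → ℝ) :
    A.pathExp I L (t + 1) (fun h => f fun i => h i.castSucc) = A.pathExp I L t f := by
  rw [pathExp_succ]
  simp only [Fin.snoc_castSucc, ← sum_mul, sum_rewardProb, sum_toReal_pmf, one_mul]

lemma pathExp_apply (f : Round M → ℝ) {n : ℕ} (i : Fin n) :
    A.pathExp I L n (fun h => f (h i)) =
      A.pathExp I L (i + 1) fun h => f (h (Fin.last i)) := by
  induction n with
  | zero => exact i.elim0
  | succ n ih =>
    refine Fin.lastCases rfl (fun j => ?_) i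
    exact (pathExp_castSucc A I L n fun h => f (h j)).trans (ih j)

lemma pathExp_one (t : ℕ) : A.pathExp I L t (fun _ => 1) = 1 := by
  induction t with
  | zero => simp [pathExp, pathProb]
  | succ n ih => exact (pathExp_castSucc A I L n fun _ => 1).trans ih

lemma pathProb_nonneg {t : ℕ} (ht : t ≤ T) (h : Fin t → Round M) :
    0 ≤ A.pathProb I L t h := by
  induction t with
  | zero => exact zero_le_one
  | succ t ih =>
    have hreward := (rewardProb_mem_stdSimplex (I.mean_mem t ht (h (Fin.last t)).2.1)).1
    exact mul_nonneg (mul_nonneg (mul_nonneg (ih (by omega) _) ENNReal.toReal_nonneg)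
      ENNReal.toReal_nonneg) (hreward (h (Fin.last t)).2.2)

lemma pathProb_mem_stdSimplex {t : ℕ} (ht : t ≤ T) :
    A.pathProb I L t ∈ stdSimplex ℝ (Fin t → Round M) :=
  ⟨pathProb_nonneg A I L ht, by simpa [pathExp] using pathExp_one A I L t⟩

lemma selectProb_nonneg {t : ℕ} (ht : t < T) (m : Fin M) : 0 ≤ A.selectProb I L t m :=
  sum_nonneg fun h _ => mul_nonneg (pathProb_nonneg A I L ht h) (by positivity)

lemma pathExp_model {n : ℕ} (i : Fin n) (g : Fin M → ℝ) :
    A.pathExp I L n (fun h => g (h i).2.1) = ∑ m, A.selectProb I L i m * g m := by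
  rw [pathExp_apply A I L (fun x => g x.2.1) i]
  simp only [selectProb, ← pathExp_mul_const, ← pathExp_sum, ite_mul, one_mul, zero_mul,
    sum_ite_eq, mem_univ, if_true]

lemma pathExp_model_reward {n : ℕ} (i : Fin n) (g : Fin M → Bool → ℝ) :
    A.pathExp I L n (fun h => g (h i).2.1 (h i).2.2) =
      ∑ m, A.selectProb I L i m * ∑ r, rewardProb (I.mean i m) r * g m r := by
  rw [← pathExp_model A I L i fun m => ∑ r, rewardProb (I.mean i m) r * g m r,
    pathExp_apply A I L (fun x => g x.2.1 x.2.2) i,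
    pathExp_apply A I L (fun x => ∑ r, rewardProb (I.mean i x.2.1) r * g x.2.1 r) i,
    pathExp_succ, pathExp_succ]
  simp only [Fin.snoc_last, ← sum_mul, sum_rewardProb, one_mul]

lemma sum_selectProb (t : ℕ) : ∑ m, A.selectProb I L t m = 1 := by
  have h := pathExp_model A I L (Fin.last t) fun _ => 1
  rw [pathExp_one] at h
  simpa using h.symm

lemma performance_eq_sum_selectProb (K : ℕ) :
    A.performance I K = ∑ t : Fin T, ∑ m, A.selectProb I (T / K) t m * I.mean t m :=
  (pathExp_sum A I (T / K) univ T fun (t : Fin T) h => I.mean t (h t).2.1).trans <|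
    sum_congr rfl fun (t : Fin T) _ => pathExp_model A I (T / K) t (I.mean t)

lemma exists_sum_selectProb_le_card_div [NeZero M] (B : Finset (Fin T)) :
    ∃ a, ∑ t ∈ B, A.selectProb I L t a ≤ (#B : ℝ) / M := by
  have hM : (M : ℝ) ≠ 0 := NeZero.ne _
  obtain ⟨a, -, ha⟩ := exists_le_of_sum_le (s := univ)
    (f := fun a => ∑ t ∈ B, A.selectProb I L t a) (g := fun _ => (#B : ℝ) / M) univ_nonempty <| by
      rw [sum_comm]
      simp [sum_selectProb, mul_div_cancel₀ _ hM]
  exact ⟨a, ha⟩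

lemma pathProb_congr {I J : RoutingInstance T M} {t : ℕ} (hIJ : ∀ i < t, I.mean i = J.mean i)
    (h : Fin t → Round M) : A.pathProb I L t h = A.pathProb J L t h := by
  induction t with
  | zero => rfl
  | succ t ih =>
    rw [pathProb_succ, pathProb_succ, ih (fun i hi => hIJ i (by omega)), hIJ t (by omega)]

lemma selectProb_congr {I J : RoutingInstance T M} {t : ℕ}
    (hIJ : ∀ i ≤ t, I.mean i = J.mean i) (m : Fin M) :
    A.selectProb I L t m = A.selectProb J L t m :=
  sum_congr rfl fun h _ => by
    rw [pathProb_congr A L (fun i hi => hIJ i (Nat.lt_succ_iff.1 hi)) h]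

end Law

section ChangeOfMeasure

variable {T M Mmax : ℕ} (A : Policy M Mmax) (L : ℕ) {I J : RoutingInstance T M}

-- The choices of the policy contribute the same factors to both laws, so they cancel out. The
-- likelihood ratio is cross-multiplied, since the probabilities of these choices may vanish.
lemma pathProb_mul_prod_rewardProb_comm (I J : RoutingInstance T M) (t : ℕ)
    (h : Fin t → Round M) :
    A.pathProb I L t h * ∏ i : Fin t, rewardProb (J.mean i (h i).2.1) (h i).2.2 =
      A.pathProb J L t h * ∏ i : Fin t, rewardProb (I.mean i (h i).2.1) (h i).2.2 := by
  induction t with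
  | zero => rfl
  | succ t ih =>
    have := ih fun i => h i.castSucc
    simp only [Fin.prod_univ_castSucc, pathProb_succ, Fin.val_castSucc, Fin.val_last]
    linear_combination (A.deployed L t (fun i => h i.castSucc) (h (Fin.last t)).1).toReal *
      (A.route t (fun i => h i.castSucc) (h (Fin.last t)).1 (h (Fin.last t)).2.1).toReal *
      rewardProb (I.mean t (h (Fin.last t)).2.1) (h (Fin.last t)).2.2 *
      rewardProb (J.mean t (h (Fin.last t)).2.1) (h (Fin.last t)).2.2 * this

lemma pathProb_ne_zero_of_ne_zero (hJ : ∀ t < T, ∀ m, J.mean t m ∈ Set.Ioo (0 : ℝ) 1)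
    {h : Fin T → Round M} (hI : A.pathProb I L T h ≠ 0) : A.pathProb J L T h ≠ 0 := by
  have hprod : ∏ i : Fin T, rewardProb (J.mean i (h i).2.1) (h i).2.2 ≠ 0 :=
    prod_ne_zero_iff.2 fun i _ => (rewardProb_pos (hJ i i.2 _) _).ne'
  have hcomm := pathProb_mul_prod_rewardProb_comm A L I J T h
  exact left_ne_zero_of_mul (hcomm ▸ mul_ne_zero hI hprod)

lemma pathProb_mul_log_div (hJ : ∀ t < T, ∀ m, J.mean t m ∈ Set.Ioo (0 : ℝ) 1)
    (h : Fin T → Round M) :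
    A.pathProb I L T h * log (A.pathProb I L T h / A.pathProb J L T h) =
      A.pathProb I L T h * ∑ i : Fin T, log (rewardProb (I.mean i (h i).2.1) (h i).2.2 /
        rewardProb (J.mean i (h i).2.1) (h i).2.2) := by
  obtain hI0 | hI0 := eq_or_ne (A.pathProb I L T h) 0
  · rw [hI0, zero_mul, zero_mul]
  have hJ0 := pathProb_ne_zero_of_ne_zero A L hJ hI0
  have hJr : ∀ i : Fin T, rewardProb (J.mean i (h i).2.1) (h i).2.2 ≠ 0 :=
    fun i => (rewardProb_pos (hJ i i.2 _) _).ne'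
  have hJprod := prod_ne_zero_iff.2 fun i (_ : i ∈ univ) => hJr i
  have hcomm := pathProb_mul_prod_rewardProb_comm A L I J T h
  have hIprod : ∏ i : Fin T, rewardProb (I.mean i (h i).2.1) (h i).2.2 ≠ 0 :=
    right_ne_zero_of_mul (hcomm ▸ mul_ne_zero hI0 hJprod)
  rw [(div_eq_div_iff hJ0 hJprod).2 (hcomm.trans (mul_comm _ _)), ← prod_div_distrib,
    log_prod fun i hi => div_ne_zero (prod_ne_zero_iff.1 hIprod i hi) (hJr i)]

lemma relEntropy_pathProb (hJ : ∀ t < T, ∀ m, J.mean t m ∈ Set.Ioo (0 : ℝ) 1) :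
    relEntropy (A.pathProb I L T) (A.pathProb J L T) = ∑ t : Fin T, ∑ m,
      A.selectProb I L t m * relEntropy (rewardProb (I.mean t m)) (rewardProb (J.mean t m)) := by
  calc relEntropy (A.pathProb I L T) (A.pathProb J L T)
      = A.pathExp I L T fun h => ∑ t : Fin T, log (rewardProb (I.mean t (h t).2.1) (h t).2.2 /
          rewardProb (J.mean t (h t).2.1) (h t).2.2) :=
        sum_congr rfl fun h _ => pathProb_mul_log_div A L hJ h
    _ = _ := by
        rw [pathExp_sum]
        exact sum_congr rfl fun t _ => pathExp_model_reward A I L t fun m r =>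
          log (rewardProb (I.mean t m) r / rewardProb (J.mean t m) r)

lemma relEntropy_pathProb_le {B : Finset (Fin T)} {a : Fin M} {δ : ℝ}
    (hJ : ∀ t < T, ∀ m, J.mean t m ∈ Set.Ioo (0 : ℝ) 1)
    (hIJ : ∀ t : Fin T, ∀ m, ¬(t ∈ B ∧ m = a) → J.mean t m = I.mean t m)
    (hδ : ∀ t ∈ B, relEntropy (rewardProb (I.mean t a)) (rewardProb (J.mean t a)) ≤ δ) :
    relEntropy (A.pathProb I L T) (A.pathProb J L T) ≤ δ * ∑ t ∈ B, A.selectProb I L t a := by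
  have houtside : ∀ t : Fin T, ∀ m, ¬(t ∈ B ∧ m = a) → A.selectProb I L t m *
      relEntropy (rewardProb (I.mean t m)) (rewardProb (J.mean t m)) = 0 := fun t m htm => by
    rw [hIJ t m htm, relEntropy_self, mul_zero]
  calc relEntropy (A.pathProb I L T) (A.pathProb J L T)
      = ∑ t : Fin T, ∑ m, A.selectProb I L t m *
          relEntropy (rewardProb (I.mean t m)) (rewardProb (J.mean t m)) :=
        relEntropy_pathProb A L hJ
    _ = ∑ t ∈ B, A.selectProb I L t a *
          relEntropy (rewardProb (I.mean t a)) (rewardProb (J.mean t a)) := by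
        rw [← sum_subset (subset_univ B) fun t _ ht =>
          sum_eq_zero fun m _ => houtside t m fun h => ht h.1]
        exact sum_congr rfl fun t _ =>
          sum_eq_single a (fun m _ hm => houtside t m fun h => hm h.2) (by simp)
    _ ≤ ∑ t ∈ B, A.selectProb I L t a * δ := sum_le_sum fun t ht =>
        mul_le_mul_of_nonneg_left (hδ t ht) (selectProb_nonneg A I L t.2 a)
    _ = δ * ∑ t ∈ B, A.selectProb I L t a := by rw [← sum_mul, mul_comm]

lemma sum_selectProb_le_add_sqrt {B : Finset (Fin T)} {a : Fin M} {δ : ℝ}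
    (hJ : ∀ t < T, ∀ m, J.mean t m ∈ Set.Ioo (0 : ℝ) 1)
    (hIJ : ∀ t : Fin T, ∀ m, ¬(t ∈ B ∧ m = a) → J.mean t m = I.mean t m)
    (hδ : ∀ t ∈ B, relEntropy (rewardProb (I.mean t a)) (rewardProb (J.mean t a)) ≤ δ) :
    ∑ t ∈ B, A.selectProb J L t a ≤
      ∑ t ∈ B, A.selectProb I L t a + #B * √(δ * ∑ t ∈ B, A.selectProb I L t a) := by
  set N : (Fin T → Round M) → ℝ := fun h => ∑ t ∈ B, if (h t).2.1 = a then 1 else 0 with hN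
  have hN_exp : ∀ I' : RoutingInstance T M,
      ∑ h, A.pathProb I' L T h * N h = ∑ t ∈ B, A.selectProb I' L t a := fun I' =>
    (pathExp_sum A I' L B T _).trans <| sum_congr rfl fun t _ =>
      pathExp_apply A I' L (fun x => if x.2.1 = a then 1 else 0) t
  have hN_mem : ∀ h, N h ∈ Set.Icc (0 : ℝ) #B := fun h =>
    ⟨sum_nonneg fun t _ => by positivity, by
      rw [← nsmul_one]
      exact sum_le_card_nsmul _ _ _ fun t _ => by split_ifs <;> norm_num⟩
  rw [← hN_exp J, ← hN_exp I]
  refine (sum_mul_le_sum_mul_add_sqrt_relEntropy (pathProb_mem_stdSimplex A I L le_rfl)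
    (pathProb_mem_stdSimplex A J L le_rfl)
    (fun h => not_imp_not.1 (pathProb_ne_zero_of_ne_zero A L hJ)) hN_mem).trans ?_
  rw [hN_exp I]
  gcongr
  exact relEntropy_pathProb_le A L hJ hIJ hδ

end ChangeOfMeasure

end Policy

section DriftInstance

variable {T M Mmax Δ : ℕ} {ε : ℝ}

/-- The rounds of batch `j` when the horizon `T` is cut into batches of length `Δ`. -/
def batch (T Δ j : ℕ) : Finset (Fin T) := univ.filter fun t => (t : ℕ) / Δ = j

lemma mem_batch {j : ℕ} {t : Fin T} : t ∈ batch T Δ j ↔ (t : ℕ) / Δ = j := by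
  simp [batch]

lemma card_batch_le (hΔ : 0 < Δ) (j : ℕ) : #(batch T Δ j) ≤ Δ := by
  refine (card_le_card_of_injOn (t := range Δ) (fun t : Fin T => (t : ℕ) % Δ)
    (fun t _ => by simpa using Nat.mod_lt _ hΔ) ?_).trans_eq (card_range Δ)
  refine fun t ht u hu (htu : (t : ℕ) % Δ = u % Δ) => Fin.ext ?_
  rw [← Nat.div_add_mod t Δ, ← Nat.div_add_mod u Δ, mem_batch.1 ht, mem_batch.1 hu, htu]

lemma sum_batch (f : Fin T → ℝ) : ∑ j ∈ range T, ∑ t ∈ batch T Δ j, f t = ∑ t, f t :=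
  sum_fiberwise_of_maps_to (g := fun t : Fin T => (t : ℕ) / Δ)
    (fun t _ => mem_range.2 ((Nat.div_le_self t Δ).trans_lt t.2)) f

/-- The means of the drifting instance with batch length `Δ`, gap `ε` and strong models `s`, where
`s j = none` means that batch `j` has no strong model, as in the reference instances of the change
of measure. -/
noncomputable def driftMean (Δ : ℕ) (ε : ℝ) (s : ℕ → Option (Fin M)) (t : ℕ) (m : Fin M) : ℝ :=
  1 / 2 + ((t / Δ : ℕ) : ℝ) * ε + if s (t / Δ) = some m then ε else 0

lemma driftMean_mem_Icc (hε : 0 ≤ ε) {t : ℕ} (ht : (((t / Δ : ℕ) : ℝ) + 1) * ε ≤ 1 / 4)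
    (s : ℕ → Option (Fin M)) (m : Fin M) :
    driftMean Δ ε s t m ∈ Set.Icc (1 / 2 : ℝ) (3 / 4) := by
  have : 0 ≤ ((t / Δ : ℕ) : ℝ) * ε := by positivity
  unfold driftMean
  constructor <;> split_ifs <;> linarith

lemma relEntropy_driftMean_le (hε : 0 ≤ ε) {t : ℕ}
    (ht : (((t / Δ : ℕ) : ℝ) + 1) * ε ≤ 1 / 4) {s s' : ℕ → Option (Fin M)} {m : Fin M}
    (hs : s (t / Δ) ≠ some m) (hs' : s' (t / Δ) = some m) :
    relEntropy (rewardProb (driftMean Δ ε s t m)) (rewardProb (driftMean Δ ε s' t m)) ≤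
      6 * ε ^ 2 := by
  obtain ⟨hp0, hp1⟩ := driftMean_mem_Icc hε ht s m
  obtain ⟨hq0, hq1⟩ := driftMean_mem_Icc hε ht s' m
  have hdiff : driftMean Δ ε s t m - driftMean Δ ε s' t m = -ε := by
    simp [driftMean, hs, hs']
  set q := driftMean Δ ε s' t m
  refine (relEntropy_rewardProb_le ⟨by linarith, by linarith⟩ ⟨by linarith, by linarith⟩).trans ?_
  have hvar : 1 / 6 ≤ q * (1 - q) := by nlinarith
  rw [hdiff, neg_sq, div_le_iff₀ (by linarith)]
  nlinarith [sq_nonneg ε]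

/-- The instance with the means `driftMean Δ ε s` in which all models are always available, have
unit cost and throughput limit one. -/
noncomputable def driftInstance (hε : 0 ≤ ε)
    (hgap : ∀ t < T, (((t / Δ : ℕ) : ℝ) + 1) * ε ≤ 1 / 4) (s : ℕ → Option (Fin M)) :
    RoutingInstance T M where
  mean := driftMean Δ ε s
  mean_mem t ht m :=
    Set.Icc_subset_Icc (by norm_num) (by norm_num) (driftMean_mem_Icc hε (hgap t ht) s m)
  cost _ := 1
  cost_pos _ := one_pos
  throughput _ := 1
  avail _ := 0

variable (hε : 0 ≤ ε) (hgap : ∀ t < T, (((t / Δ : ℕ) : ℝ) + 1) * ε ≤ 1 / 4)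

lemma isDriftingBatch_driftInstance (s : ℕ → Fin M) :
    (driftInstance hε hgap fun j => some (s j)).IsDriftingBatch Δ ε s where
  strong t _ := by simp only [driftInstance, driftMean, if_true]; ring
  weak t _ m hm := by simp [driftInstance, driftMean, hm.symm]
  cost_eq _ := rfl
  throughput_eq _ := rfl
  avail_eq _ := rfl

lemma selectProb_driftInstance_congr (A : Policy M Mmax) (L : ℕ) {s s' : ℕ → Option (Fin M)}
    {t : ℕ} (hs : ∀ j ≤ t / Δ, s j = s' j) (m : Fin M) :
    A.selectProb (driftInstance hε hgap s) L t m =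
      A.selectProb (driftInstance hε hgap s') L t m := by
  refine A.selectProb_congr L (fun i hi => ?_) m
  funext m
  simp only [driftInstance, driftMean, hs _ (Nat.div_le_div_right hi)]

lemma exists_sum_selectProb_update_le (A : Policy M Mmax) (L : ℕ) (hM : 2 ≤ M) (hΔ : 0 < Δ)
    (hεΔ : 96 * (ε ^ 2 * Δ) ≤ M) (s : ℕ → Option (Fin M)) (j : ℕ) :
    ∃ a, ∑ t ∈ batch T Δ j,
        A.selectProb (driftInstance hε hgap (Function.update s j (some a))) L t a ≤
      3 / 4 * #(batch T Δ j) := by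
  have : NeZero M := ⟨by omega⟩
  have hM2 : (2 : ℝ) ≤ M := by exact_mod_cast hM
  set B := batch T Δ j
  obtain ⟨a, ha⟩ := A.exists_sum_selectProb_le_card_div
    (driftInstance hε hgap (Function.update s j none)) L B
  refine ⟨a, (A.sum_selectProb_le_add_sqrt L (a := a) (δ := 6 * ε ^ 2)
    (I := driftInstance hε hgap (Function.update s j none)) (fun t ht m => ?_)
    (fun t m htm => ?_) fun t ht => ?_).trans ?_⟩
  · exact Set.Icc_subset_Ioo (by norm_num) (by norm_num) (driftMean_mem_Icc hε (hgap t ht) _ m)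
  · by_cases ht : (t : ℕ) / Δ = j
    · have hm : a ≠ m := fun hm => htm ⟨mem_batch.2 ht, hm.symm⟩
      simp [driftInstance, driftMean, ht, hm]
    · simp only [driftInstance, driftMean, Function.update_of_ne ht]
  · exact relEntropy_driftMean_le hε (hgap t t.2) (by simp [mem_batch.1 ht])
      (by simp [mem_batch.1 ht])
  set n := ∑ t ∈ B, A.selectProb (driftInstance hε hgap (Function.update s j none)) L t a
  have hcard : (#B : ℝ) ≤ Δ := by exact_mod_cast card_batch_le hΔ j
  have hn : n ≤ #B / 2 := ha.trans (by gcongr)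
  have hentropy : 6 * ε ^ 2 * n ≤ (1 / 4) ^ 2 := by
    have : ε ^ 2 * n ≤ ε ^ 2 * Δ / M := by
      rw [mul_div_assoc]
      gcongr
      exact ha.trans (by gcongr)
    have : ε ^ 2 * Δ / M ≤ 1 / 96 := by
      rw [div_le_iff₀ (by linarith)]
      linarith
    linarith
  have hsqrt : √(6 * ε ^ 2 * n) ≤ 1 / 4 := (sqrt_le_left (by norm_num)).2 hentropy
  linarith [mul_le_mul_of_nonneg_left hsqrt (Nat.cast_nonneg (α := ℝ) #B)]

lemma exists_forall_sum_selectProb_le (A : Policy M Mmax) (L : ℕ) (hM : 2 ≤ M) (hΔ : 0 < Δ)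
    (hεΔ : 96 * (ε ^ 2 * Δ) ≤ M) (n : ℕ) :
    ∃ s : ℕ → Fin M, ∀ j < n, ∑ t ∈ batch T Δ j,
        A.selectProb (driftInstance hε hgap fun i => some (s i)) L t (s j) ≤
      3 / 4 * #(batch T Δ j) := by
  induction n with
  | zero => exact ⟨fun _ => ⟨0, by omega⟩, by simp⟩
  | succ n ih =>
    obtain ⟨s, hs⟩ := ih
    obtain ⟨a, ha⟩ := exists_sum_selectProb_update_le hε hgap A L hM hΔ hεΔ (some ∘ s) n
    have hupdate : (fun i => some (Function.update s n a i)) =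
        Function.update (some ∘ s) n (some a) := Function.comp_update some s n a
    refine ⟨Function.update s n a, fun j hj => ?_⟩
    rw [hupdate]
    obtain rfl | hjn := eq_or_ne j n
    · rwa [Function.update_self]
    · rw [Function.update_of_ne hjn]
      refine (sum_congr rfl fun t ht => ?_).trans_le (hs j (by omega))
      refine selectProb_driftInstance_congr hε hgap A L (fun i hi => ?_) _
      rw [mem_batch.1 ht] at hi
      exact Function.update_of_ne (by omega) _ _

lemma exists_sum_selectProb_strong_le (A : Policy M Mmax) (L : ℕ) (hM : 2 ≤ M) (hΔ : 0 < Δ)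
    (hεΔ : 96 * (ε ^ 2 * Δ) ≤ M) :
    ∃ s : ℕ → Fin M, ∑ t : Fin T,
        A.selectProb (driftInstance hε hgap fun i => some (s i)) L t (s (t / Δ)) ≤ 3 / 4 * T := by
  obtain ⟨s, hs⟩ := exists_forall_sum_selectProb_le hε hgap A L hM hΔ hεΔ T
  have hcard : ∑ j ∈ range T, (#(batch T Δ j) : ℝ) = T := by
    simpa using sum_batch (T := T) (Δ := Δ) fun _ => 1
  refine ⟨s, ?_⟩
  rw [← hcard, mul_sum, ← sum_batch (Δ := Δ)]
  refine sum_le_sum fun j hj => (sum_congr rfl fun t ht => ?_).trans_le (hs j (mem_range.1 hj))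
  rw [mem_batch.1 ht]

end DriftInstance

section Regret

variable {T M Mmax Δ : ℕ} {ε b : ℝ} {I : RoutingInstance T M} {s : ℕ → Fin M}

lemma sum_range_mul_div (K : ℕ) {L : ℕ} (hL : 0 < L) (f : ℕ → ℝ) :
    ∑ t ∈ range (K * L), f (t / L) = ∑ k ∈ range K, (L : ℝ) * f k := by
  induction K with
  | zero => simp
  | succ K ih =>
    have hblock : ∀ i ∈ range L, f ((K * L + i) / L) = f K := fun i hi => by
      rw [mul_comm K L, Nat.mul_add_div hL, Nat.div_eq_of_lt (mem_range.1 hi), add_zero]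
    rw [Nat.succ_mul, sum_range_add, ih, sum_range_succ, sum_congr rfl hblock, sum_const,
      card_range, nsmul_eq_mul]

lemma RoutingInstance.mean_le_rate {t : ℕ} (ht : t < T) {S : Finset (Fin M)} {m : Fin M}
    (hm : m ∈ S) (hcost : I.cost m ≤ b) (hthroughput : 1 ≤ I.throughput m)
    (hthroughput₀ : ∀ m' ∈ S, 0 ≤ I.throughput m') (hMmax : 0 < Mmax) :
    I.mean t m ≤ I.rate t b Mmax S := by
  refine le_csSup ⟨1, ?_⟩ ⟨Pi.single m 1, fun m' => ?_, fun m' hm' => ?_, by simp,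
    by simpa [Pi.single_apply], fun m' hm' => ?_, ?_, by simp [Pi.single_apply]⟩
  · rintro v ⟨p, hp0, -, hp1, -, -, -, rfl⟩
    rw [← hp1]
    exact sum_le_sum fun m _ => mul_le_of_le_one_left (hp0 m) (I.mean_mem t ht m).2
  · rw [Pi.single_apply]
    positivity
  · exact Pi.single_eq_of_ne (ne_of_mem_of_not_mem hm hm').symm _
  · rw [Pi.single_apply]
    split_ifs with h
    exacts [h ▸ hthroughput, hthroughput₀ m' hm']
  · simpa [Pi.single_apply, filter_eq'] using Nat.succ_le_of_lt hMmax

namespace RoutingInstance.IsDriftingBatch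

lemma le_rate_pool (hI : I.IsDriftingBatch Δ ε s) (hb : 1 ≤ b) (hMmax : 0 < Mmax) {t : ℕ}
    (ht : t < T) : 1 / 2 + (((t / Δ : ℕ) : ℝ) + 1) * ε ≤ I.rate t b Mmax (I.pool t) := by
  rw [← hI.strong t ht]
  exact mean_le_rate ht (by simp [pool, hI.avail_eq]) (by rwa [hI.cost_eq])
    (hI.throughput_eq _).ge (fun m _ => by simp [hI.throughput_eq]) hMmax

lemma mean_eq (hI : I.IsDriftingBatch Δ ε s) {t : ℕ} (ht : t < T) (m : Fin M) :
    I.mean t m = 1 / 2 + ((t / Δ : ℕ) : ℝ) * ε + if m = s (t / Δ) then ε else 0 := by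
  split_ifs with hm
  · rw [hm, hI.strong t ht]
    ring
  · rw [hI.weak t ht m hm, add_zero]

lemma sum_strong_sub_performance (hI : I.IsDriftingBatch Δ ε s) (A : Policy M Mmax) (K : ℕ) :
    ∑ t ∈ range T, (1 / 2 + (((t / Δ : ℕ) : ℝ) + 1) * ε) - A.performance I K =
      ε * (T - ∑ t : Fin T, A.selectProb I (T / K) t (s (t / Δ))) := by
  have hround : ∀ t : Fin T, ∑ m, A.selectProb I (T / K) t m * I.mean t m =
      1 / 2 + ((t / Δ : ℕ) : ℝ) * ε + A.selectProb I (T / K) t (s (t / Δ)) * ε := fun t => by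
    simp only [hI.mean_eq t.2, mul_add, sum_add_distrib, ← sum_mul, A.sum_selectProb]
    simp
  have hT : (T : ℝ) = ∑ _t : Fin T, 1 := by simp
  simp only [A.performance_eq_sum_selectProb, sum_range, hround]
  rw [hT, ← sum_sub_distrib, ← sum_sub_distrib, mul_sum]
  exact sum_congr rfl fun t _ => by ring

lemma le_regret (hI : I.IsDriftingBatch Δ ε s) (hb : 1 ≤ b) (hMmax : 0 < Mmax)
    (A : Policy M Mmax) (K : ℕ) :
    ε * (T - ∑ t : Fin T, A.selectProb I (T / K) t (s (t / Δ))) ≤ A.regret I K b := by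
  rw [← hI.sum_strong_sub_performance]
  exact sub_le_sub_right
    (sum_le_sum fun t ht => hI.le_rate_pool hb hMmax (mem_range.1 ht)) _

lemma sum_strong_le_stage_benchmark (hI : I.IsDriftingBatch Δ ε s) (hb : 1 ≤ b)
    (hMmax : 0 < Mmax) {K : ℕ} (hK : K ∣ T) (hΔ : 0 < Δ) (hdvd : T / K ∣ Δ) :
    ∑ t ∈ range T, (1 / 2 + (((t / Δ : ℕ) : ℝ) + 1) * ε) ≤
      ∑ k ∈ range K, ((T / K : ℕ) : ℝ) * I.rate (k * (T / K)) b Mmax (I.pool (k * (T / K))) := by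
  obtain ⟨L, hL⟩ : ∃ L, T / K = L := ⟨_, rfl⟩
  have hL0 : 0 < L := hL ▸ Nat.pos_of_dvd_of_pos hdvd hΔ
  have hT : K * L = T := hL ▸ Nat.mul_div_cancel' hK
  rw [hL] at hdvd ⊢
  obtain ⟨d, rfl⟩ := hdvd
  -- Since `Δ = L d`, the batch of a round depends only on its stage.
  simp only [← hT, ← Nat.div_div_eq_div_mul]
  rw [sum_range_mul_div K hL0 fun k => 1 / 2 + (((k / d : ℕ) : ℝ) + 1) * ε]
  refine sum_le_sum fun k hk => mul_le_mul_of_nonneg_left ?_ (Nat.cast_nonneg _)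
  have := hI.le_rate_pool hb hMmax (t := k * L)
    (hT ▸ Nat.mul_lt_mul_of_pos_right (mem_range.1 hk) hL0)
  rwa [← Nat.div_div_eq_div_mul, Nat.mul_div_cancel k hL0] at this

lemma le_stageRegret (hI : I.IsDriftingBatch Δ ε s) (hb : 1 ≤ b) (hMmax : 0 < Mmax)
    (A : Policy M Mmax) {K : ℕ} (hK : K ∣ T) (hΔ : 0 < Δ) (hdvd : T / K ∣ Δ) :
    ε * (T - ∑ t : Fin T, A.selectProb I (T / K) t (s (t / Δ))) ≤ A.stageRegret I K b := by
  rw [← hI.sum_strong_sub_performance]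
  exact sub_le_sub_right (hI.sum_strong_le_stage_benchmark hb hMmax hK hΔ hdvd) _

end RoutingInstance.IsDriftingBatch

theorem exists_isDriftingBatch_le_regret (A : Policy M Mmax) {K : ℕ} (hM : 2 ≤ M) (hK : K ∣ T)
    (hε : 0 ≤ ε) (hgap : ∀ t < T, (((t / Δ : ℕ) : ℝ) + 1) * ε ≤ 1 / 4) (hΔ : 0 < Δ)
    (hεΔ : 96 * (ε ^ 2 * Δ) ≤ M) (hb : 1 ≤ b) (hMmax : 0 < Mmax) :
    ∃ (s : ℕ → Fin M) (I : RoutingInstance T M), I.IsDriftingBatch Δ ε s ∧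
      ε * T / 4 ≤ A.regret I K b ∧ (T / K ∣ Δ → ε * T / 4 ≤ A.stageRegret I K b) := by
  obtain ⟨s, hs⟩ := exists_sum_selectProb_strong_le hε hgap A (T / K) hM hΔ hεΔ
  have hI := isDriftingBatch_driftInstance hε hgap s
  have hmissed := mul_le_mul_of_nonneg_left (sub_le_sub_left hs (T : ℝ)) hε
  refine ⟨s, _, hI, le_trans ?_ (hI.le_regret hb hMmax A K), fun hdvd =>
    le_trans ?_ (hI.le_stageRegret hb hMmax A hK hΔ hdvd)⟩ <;> linarith

end Regret

section Parameters

lemma add_one_mul_le_of_ceil_mul_le {T Δ : ℕ} {ε c : ℝ} (hΔ : 0 < Δ) (hε : 0 ≤ ε)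
    (h : (⌈(T : ℝ) / (Δ : ℝ)⌉₊ : ℝ) * ε ≤ c) {t : ℕ} (ht : t < T) :
    (((t / Δ : ℕ) : ℝ) + 1) * ε ≤ c := by
  have hlt : t / Δ < ⌈(T : ℝ) / (Δ : ℝ)⌉₊ := Nat.lt_ceil.2 <| Nat.cast_div_le.trans_lt (by gcongr)
  refine le_trans (mul_le_mul_of_nonneg_right ?_ hε) h
  exact_mod_cast hlt

lemma ceil_div_mul_le_two {T Δ : ℕ} {x : ℝ} (hΔ : 0 < Δ) (hx0 : 0 ≤ x) (hx1 : x ≤ 1)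
    (hxΔ : x * T ≤ Δ) : (⌈(T : ℝ) / (Δ : ℝ)⌉₊ : ℝ) * x ≤ 2 := by
  have hΔ' : (0 : ℝ) < Δ := by exact_mod_cast hΔ
  have hdiv : (T : ℝ) / Δ * x ≤ 1 := by
    rwa [div_mul_eq_mul_div, div_le_one hΔ', mul_comm]
  have hceil := (Nat.ceil_lt_add_one (a := (T : ℝ) / Δ) (by positivity)).le
  linarith [mul_le_mul_of_nonneg_right hceil hx0]

lemma exists_dvd_batch_length {T L : ℕ} (hL : L ∣ T) (hT : 0 < T) {X : ℝ} (hX : 0 < X)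
    (hXT : X ≤ T) (hLX : (L : ℝ) ≤ 2 * X) :
    ∃ Δ : ℕ, 0 < Δ ∧ Δ ≤ T ∧ X ≤ Δ ∧ (Δ : ℝ) ≤ 3 * X ∧ L ∣ Δ := by
  obtain ⟨K, rfl⟩ := hL
  have hL0 : 0 < L := Nat.pos_of_mul_pos_right hT
  have hL0' : (0 : ℝ) < L := by exact_mod_cast hL0
  have hlower := Nat.le_ceil (X / L)
  have hupper := (Nat.ceil_lt_add_one (div_pos hX hL0').le).le
  rw [div_le_iff₀' hL0'] at hlower
  rw [← sub_le_iff_le_add, le_div_iff₀' hL0'] at hupper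
  refine ⟨L * ⌈X / L⌉₊, Nat.mul_pos hL0 (Nat.ceil_pos.2 (div_pos hX hL0')),
    Nat.mul_le_mul_left L (Nat.ceil_le.2 ?_), by exact_mod_cast hlower, ?_, dvd_mul_right _ _⟩
  · rw [div_le_iff₀' hL0']
    exact_mod_cast hXT
  · push_cast
    linarith

lemma exists_batch_length {T L : ℕ} (hL : L ∣ T) {X : ℝ} (hX : 1 ≤ X) (hXT : X ≤ T) :
    ∃ Δ : ℕ, 0 < Δ ∧ Δ ≤ T ∧ X ≤ Δ ∧ (Δ : ℝ) ≤ 3 * X ∧ ((L : ℝ) ≤ 2 * X → L ∣ Δ) := by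
  have hT : 0 < T := by exact_mod_cast zero_lt_one.trans_le (hX.trans hXT)
  by_cases hLX : (L : ℝ) ≤ 2 * X
  · simpa [hLX] using exists_dvd_batch_length hL hT (by linarith) hXT hLX
  · simpa [hLX] using exists_dvd_batch_length (one_dvd T) hT (by linarith) hXT
      (by push_cast; linarith)

lemma div_rpow_third_mul {m t : ℝ} (hm : 0 ≤ m) (ht : 0 < t) :
    (m / t) ^ (1 / 3 : ℝ) * t = m ^ (1 / 3 : ℝ) * t ^ (2 / 3 : ℝ) := by
  rw [div_rpow hm ht.le, div_mul_eq_mul_div, div_eq_iff (by positivity), mul_assoc,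
    ← rpow_add ht]
  norm_num

lemma div_rpow_third_pow_three_mul {m t : ℝ} (hm : 0 ≤ m) (ht : 0 < t) :
    ((m / t) ^ (1 / 3 : ℝ)) ^ 3 * t = m := by
  have hcube : ((m / t) ^ (1 / 3 : ℝ)) ^ 3 = m / t := by
    simpa using rpow_inv_natCast_pow (div_nonneg hm ht.le) three_ne_zero
  rw [hcube, div_mul_cancel₀ _ ht.ne']

lemma stage_length_le {M T K : ℕ} {X : ℝ} (hX : 0 ≤ X) (hX3 : X ^ 3 = M * T ^ 2)
    (hT : (T : ℝ) ≤ 2 * M * K ^ 3) : ((T / K : ℕ) : ℝ) ≤ 2 * X := by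
  obtain rfl | hK := K.eq_zero_or_pos
  · simpa using hX
  refine Nat.cast_div_le.trans (le_of_pow_le_pow_left₀ three_ne_zero (by positivity) ?_)
  rw [mul_pow, hX3, div_pow, div_le_iff₀ (by positivity)]
  have hmul := mul_le_mul_of_nonneg_left hT (sq_nonneg (T : ℝ))
  have : 0 ≤ (M : ℝ) * T ^ 2 * K ^ 3 := by positivity
  linarith

lemma exists_drift_parameters {M T K : ℕ} (hK : K ∣ T) {x : ℝ} (hx0 : 0 ≤ x) (hx1 : x ≤ 1)
    (hx3 : x ^ 3 * T = M) (hxT : 1 ≤ x * T) :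
    ∃ Δ : ℕ, 0 < Δ ∧ Δ ≤ T ∧ x * T ≤ Δ ∧ (Δ : ℝ) ≤ 3 * (x * T) ∧
      (⌈(T : ℝ) / (Δ : ℝ)⌉₊ : ℝ) * (x / 32) ≤ 1 / 4 ∧ 96 * ((x / 32) ^ 2 * Δ) ≤ M ∧
      ((T : ℝ) ≤ 2 * M * K ^ 3 → T / K ∣ Δ) := by
  obtain ⟨Δ, hΔ, hΔT, hlower, hupper, hdvd⟩ := exists_batch_length (Nat.div_dvd_of_dvd hK) hxT
    (mul_le_of_le_one_left (Nat.cast_nonneg T) hx1)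
  refine ⟨Δ, hΔ, hΔT, hlower, hupper, ?_, ?_, fun hT => hdvd <|
    stage_length_le (M := M) (by linarith) (by rw [← hx3]; ring) hT⟩
  · linarith [ceil_div_mul_le_two hΔ hx0 hx1 hlower]
  · have hinfo : x ^ 2 * Δ ≤ 3 * M := by
      calc x ^ 2 * Δ ≤ x ^ 2 * (3 * (x * T)) := by gcongr
        _ = 3 * (M : ℝ) := by rw [← hx3]; ring
    have : (0 : ℝ) ≤ M := M.cast_nonneg
    linarith

end Parameters

end LLMRouting

open LLMRouting in
theorem theorem2 :
    ∃ c c₁ c₂ C₀ : ℝ, 0 < c ∧ 0 < c₁ ∧ 0 < c₂ ∧ 0 < C₀ ∧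
      ∀ M T K : ℕ, 2 ≤ M → C₀ * (M : ℝ) ≤ (T : ℝ) → 0 < K → K ∣ T →
      ∃ (Δ : ℕ) (ε : ℝ),
        0 < Δ ∧ Δ ≤ T ∧
        c₁ * ((M : ℝ) ^ (1 / 3 : ℝ) * (T : ℝ) ^ (2 / 3 : ℝ)) ≤ (Δ : ℝ) ∧
        (Δ : ℝ) ≤ c₂ * ((M : ℝ) ^ (1 / 3 : ℝ) * (T : ℝ) ^ (2 / 3 : ℝ)) ∧
        c₁ * ((M : ℝ) / (T : ℝ)) ^ (1 / 3 : ℝ) ≤ ε ∧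
        ε ≤ c₂ * ((M : ℝ) / (T : ℝ)) ^ (1 / 3 : ℝ) ∧
        (⌈(T : ℝ) / (Δ : ℝ)⌉₊ : ℝ) * ε ≤ 1 / 4 ∧
        ∀ (Mmax : ℕ) (b : ℝ), 0 < Mmax → 1 ≤ b →
        ∀ A : LLMRouting.Policy M Mmax,
          ∃ (s : ℕ → Fin M) (I : LLMRouting.RoutingInstance T M),
            I.IsDriftingBatch Δ ε s ∧
            c * ((M : ℝ) ^ (1 / 3 : ℝ) * (T : ℝ) ^ (2 / 3 : ℝ)) ≤ A.regret I K b ∧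
            ((T : ℝ) ≤ 2 * C₀ * (M : ℝ) * (K : ℝ) ^ 3 →
              c * ((M : ℝ) ^ (1 / 3 : ℝ) * (T : ℝ) ^ (2 / 3 : ℝ)) ≤ A.stageRegret I K b) := by
  refine ⟨1 / 128, 1 / 32, 3, 1, by norm_num, by norm_num, by norm_num, by norm_num, ?_⟩
  intro M T K hM hMT _ hKT
  rw [one_mul] at hMT
  have hM1 : (1 : ℝ) ≤ M := by exact_mod_cast one_le_two.trans hM
  have hT1 : (1 : ℝ) ≤ T := hM1.trans hMT
  have hX : (1 : ℝ) ≤ (M : ℝ) ^ (1 / 3 : ℝ) * (T : ℝ) ^ (2 / 3 : ℝ) :=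
    one_le_mul_of_one_le_of_one_le (Real.one_le_rpow hM1 (by norm_num))
      (Real.one_le_rpow hT1 (by norm_num))
  have hx1 : ((M : ℝ) / T) ^ (1 / 3 : ℝ) ≤ 1 :=
    Real.rpow_le_one (by positivity) (div_le_one_of_le₀ hMT (by positivity)) (by norm_num)
  have hx3 := div_rpow_third_pow_three_mul (m := M) (t := T) (by positivity) (by positivity)
  rw [← div_rpow_third_mul (by positivity) (by positivity)] at hX ⊢
  set x := ((M : ℝ) / T) ^ (1 / 3 : ℝ)
  have hx0 : 0 ≤ x := by positivity
  obtain ⟨Δ, hΔ, hΔT, hlower, hupper, hgap, hinfo, hdvd⟩ :=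
    exists_drift_parameters hKT hx0 hx1 hx3 hX
  refine ⟨Δ, x / 32, hΔ, hΔT, by linarith, hupper, by linarith, by linarith, hgap, ?_⟩
  intro Mmax b hMmax hb A
  obtain ⟨s, I, hI, hregret, hstage⟩ := exists_isDriftingBatch_le_regret A hM hKT
    (by positivity) (fun t => add_one_mul_le_of_ceil_mul_le hΔ (by positivity) hgap) hΔ hinfo hb
    hMmax
  exact ⟨s, I, hI, by linarith, fun hTK => by linarith [hstage (hdvd (by linarith))]⟩
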